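/- **Theorem.** A parity game is a tuple $\mathcal{G}=(S,S_0,S_1,R,c)$ where $S$ is a finite set of states, $S_0$ and $S_1$ partition $S$ ($S_j$ being the states controlled by player $j\in\{0,1\}$), $R\subseteq S\times S$ is a total transition relation (every state has an $R$-successor), and $c:S\to\{1,\dots,d\}$ is a coloring. A *play* is an infinite sequence $\rho=s_0s_1\cdots$ of states with $(s_i,s_{i+1})\in R$ for all $i$; a *history* is a finite non-empty prefix of a play; $c(\rho)=c(s_0)c(s_1)\cdots$, and $c(P)=\{c(\rho)\mid\rho\in P\}$ for a set $P$ of plays. A *strategy* $\sigma$ for player $j$ assigns to each history $s_0\cdots s_k$ with $s_k\in S_j$ a state $\sigma(s_0\cdots s_k)$ with $(s_k,\sigma(s_0\cdots s_k))\in R$; it is *memoryless* if its value depends only on $s_k$. $\mathrm{Play}(\mathcal{G},s,\sigma)$ is the set of plays $s_0s_1\cdots$ with $s_0=s$ and $\sigma(s_0\cdots s_i)=s_{i+1}$ whenever $s_i\in S_j$. For $j\in\{0,1\}$ let $$\Omega_j=\{\pi\in\mathbb{N}^\omega\mid \pi\text{ is bounded and the greatest number occurring infinitely often in }\pi\text{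 is}\equiv j \pmod 2\},$$ $$\Lambda_j=\{\pi\in\Omega_j\mid \max_{i>0}\pi_i\equiv j\pmod 2\}.$$ The *winning region* $W_j(\mathcal{G})$ (resp. the *winning core* $A_j(\mathcal{G})$) is the set of states $s$ for which player $j$ has a strategy $\sigma$ with $c(\mathrm{Play}(\mathcal{G},s,\sigma))\subseteq\Omega_j$ (resp. $\subseteq\Lambda_j$). Let $\mathcal{G}$ be a parity game and let $j\in\{0,1\}$ be a player. Then there is a memoryless strategy $\sigma$ for player $j$ such that 1. $c(\mathrm{Play}(\mathcal{G},s,\sigma))\subseteq\Lambda_j$ for every $s\in A_j(\mathcal{G})$; 2. $c(\mathrm{Play}(\mathcal{G},s,\sigma))\subseteq\Omega_j$ for every $s\in W_j(\mathcal{G})$; 3. $c(\mathrm{Play}(\mathcal{G},s,\sigma))\cap\Lambda_{1-j}=\emptyset$ for every $s\notin A_{1-j}(\mathcal{G})$. -/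

import Mathlib

open Set Filter

/-- A parity game with state set `S`: finitely many states, partitioned into the states
`owned 0` of player 0 and `owned 1` of player 1, a total transition relation `R`, and
colors in `{1, ..., d}`. Players are the elements of `Fin 2`; the opponent of `j` is `1 - j`. -/
structure ParityGame (S : Type*) where
  finite_states : Finite S
  owned : Fin 2 → Set S
  owned_union : owned 0 ∪ owned 1 = univ
  owned_inter : owned 0 ∩ owned 1 = ∅
  R : S → S → Prop
  R_total : ∀ s, ∃ t, R s t
  d : ℕ
  color : S → ℕ
  color_mem : ∀ s, color s ∈ Finset.Icc 1 d

/-- The colors that occur infinitely often in a sequence. -/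
def infColors (π : ℕ → ℕ) : Set ℕ := {e | ∃ᶠ i in atTop, π i = e}

/-- The parity objective `Ω_j`: bounded sequences in which the greatest number occurring
infinitely often is congruent to `j` modulo 2. -/
def parityObjective (j : Fin 2) : Set (ℕ → ℕ) :=
  {π | (∃ k, ∀ i, π i ≤ k) ∧ ∃ e, IsGreatest (infColors π) e ∧ e ≡ (j : ℕ) [MOD 2]}

/-- The objective `Λ_j`: sequences in `Ω_j` whose greatest non-initial element is congruent
to `j` modulo 2. -/
def coreObjective (j : Fin 2) : Set (ℕ → ℕ) :=
  {π | π ∈ parityObjective j ∧ ∃ m, IsGreatest (π '' {i | 0 < i}) m ∧ m ≡ (j : ℕ) [MOD 2]}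

namespace ParityGame

variable {S : Type*} (G : ParityGame S)

/-- Plays: infinite sequences of states that respect the transition relation. -/
def IsPlay (ρ : ℕ → S) : Prop := ∀ i, G.R (ρ i) (ρ (i + 1))

/-- The sequence `c(ρ)` of colors along a sequence `ρ` of states. -/
def colorSeq (ρ : ℕ → S) : ℕ → ℕ := fun i => G.color (ρ i)

/-- Histories: finite non-empty prefixes of plays. -/
structure History where
  states : List S
  isPrefix : ∃ ρ, G.IsPlay ρ ∧ ∃ k, states = (List.range (k + 1)).map ρ

variable {G}

theorem History.states_ne_nil (h : G.History) : h.states ≠ [] := by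
  obtain ⟨ρ, -, k, hk⟩ := h.isPrefix
  simp [hk]

/-- The last state of a history. -/
def History.last (h : G.History) : S := h.states.getLast h.states_ne_nil

/-- The prefix `ρ 0, ..., ρ k` of a play. -/
def IsPlay.take {ρ : ℕ → S} (hρ : G.IsPlay ρ) (k : ℕ) : G.History where
  states := (List.range (k + 1)).map ρ
  isPrefix := ⟨ρ, hρ, k, rfl⟩

theorem IsPlay.last_take {ρ : ℕ → S} (hρ : G.IsPlay ρ) (k : ℕ) : (hρ.take k).last = ρ k := by
  simp [History.last, IsPlay.take]

variable (G)

/-- A strategy for player `j`: a function on the histories whose last state is owned by `j`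
that picks a successor of that last state. -/
structure Strategy (j : Fin 2) where
  move : (h : G.History) → h.last ∈ G.owned j → S
  move_mem : ∀ h hj, G.R h.last (move h hj)

variable {G}

/-- A strategy is memoryless if its choice depends only on the last state of the history. -/
def Strategy.IsMemoryless {j : Fin 2} (σ : G.Strategy j) : Prop :=
  ∀ (h h' : G.History) (hj : h.last ∈ G.owned j) (hj' : h'.last ∈ G.owned j),
    h.last = h'.last → σ.move h hj = σ.move h' hj'

/-- A play is compatible with `σ` if every move from a state of player `j` is the one
prescribed by `σ` for the history so far. -/
def Strategy.Compatible {j : Fin 2} (σ : G.Strategy j) {ρ : ℕ → S} (hρ : G.IsPlay ρ) : Prop :=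
  ∀ (i : ℕ) (hi : ρ i ∈ G.owned j),
    σ.move (hρ.take i) ((hρ.last_take i).symm ▸ hi) = ρ (i + 1)

/-- `Play(G, s, σ)`: the plays from `s` that are compatible with `σ`. -/
def Strategy.playsFrom {j : Fin 2} (σ : G.Strategy j) (s : S) : Set (ℕ → S) :=
  {ρ | ρ 0 = s ∧ ∃ hρ : G.IsPlay ρ, σ.Compatible hρ}

variable (G)

/-- The winning region `W_j(G)`. -/
def winningRegion (j : Fin 2) : Set S :=
  {s | ∃ σ : G.Strategy j, G.colorSeq '' σ.playsFrom s ⊆ parityObjective j}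

/-- The winning core `A_j(G)`. -/
def winningCore (j : Fin 2) : Set S :=
  {s | ∃ σ : G.Strategy j, G.colorSeq '' σ.playsFrom s ⊆ coreObjective j}

end ParityGame

/-! Both objectives are thresholds of a single integer payoff. Let `e` be the greatest color seen
infinitely often and `m` the greatest non-initial color. The payoff `±(2d+2) ± m`, with signs given
by the parities of `e` and `m`, is positive exactly on `Ω_j`, exceeds `2d+2` exactly on `Λ_j`, and
lies below `-(2d+2)` exactly on `Λ_{1-j}`. A positional strategy optimal from every state therefore
satisfies all three claims at once.

Such strategies exist for both players by induction on the number of edges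
(`hasPosValue_of_loopSelective`). At a state `s` with a choice, the moves are split into two sets,
and the owner of `s` needs only the better half. The opponent answers with the optimal strategy for
the half used at the last visit to `s` (`ensures_of_restrictAt`). This works because mixing cycles
through `s` is no better than repeating one of them or never returning (`LoopSelective`), and
because improving a suffix improves the play (`PrefixMonotone`). The parity payoff has both
properties. -/

/-! ### Games on graphs with an integer payoff -/

/-- The suffix of a sequence from position `k` on. -/
def seqDrop {S : Type*} (k : ℕ) (x : ℕ → S) : ℕ → S := fun n => x (k + n)

/-- The periodic repetition of the segment `x i, ..., x (k - 1)`. -/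
def seqLoop {S : Type*} (i k : ℕ) (x : ℕ → S) : ℕ → S := fun n => x (i + n % (k - i))

/-- The list `x n, ..., x 0`. -/
def seqHist {S : Type*} (x : ℕ → S) : ℕ → List S
  | 0 => [x 0]
  | n + 1 => x (n + 1) :: seqHist x n

theorem seqHist_eq_cons {S : Type*} (x : ℕ → S) (n : ℕ) : ∃ l, seqHist x n = x n :: l := by
  cases n <;> exact ⟨_, rfl⟩

theorem seqHist_reverse {S : Type*} (x : ℕ → S) (n : ℕ) :
    (seqHist x n).reverse = (List.range (n + 1)).map x := by
  induction n with
  | zero => simp [seqHist]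
  | succ n ih => rw [seqHist, List.reverse_cons, ih, List.range_succ (n := n + 1)]; simp

/-- Infinite paths of the relation `E`. -/
def IsPath {S : Type*} (E : S → S → Prop) (x : ℕ → S) : Prop := ∀ i, E (x i) (x (i + 1))

/-- The sequence `x` follows the positional strategy `σ` at the states in `A`. -/
def FollowsPos {S : Type*} (A : Set S) (σ : S → S) (x : ℕ → S) : Prop :=
  ∀ i, x i ∈ A → x (i + 1) = σ (x i)

/-- The sequence `x` follows the history dependent strategy `σ` at the states in `A`. -/
def FollowsHist {S : Type*} (A : Set S) (σ : List S → S) (x : ℕ → S) : Prop :=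
  ∀ i, x i ∈ A → x (i + 1) = σ (seqHist x i)

/-- The owner of `A` has a positional strategy that guarantees payoff `v s` from every `s`. -/
def EnsuresPos {S : Type*} (E : S → S → Prop) (A : Set S) (f : (ℕ → S) → ℤ) (v : S → ℤ) : Prop :=
  ∃ σ : S → S, (∀ s ∈ A, E s (σ s)) ∧
    ∀ x, IsPath E x → FollowsPos A σ x → v (x 0) ≤ f x

/-- The owner of `A` has a strategy that guarantees payoff `v s` from every `s`. -/
def EnsuresHist {S : Type*} (E : S → S → Prop) (A : Set S) (f : (ℕ → S) → ℤ) (v : S → ℤ) : Prop :=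
  ∃ σ : List S → S, (∀ s ∈ A, ∀ l, E s (σ (s :: l))) ∧
    ∀ x, IsPath E x → FollowsHist A σ x → v (x 0) ≤ f x

/-- Both players have optimal positional strategies. -/
def HasPosValue {S : Type*} (E : S → S → Prop) (A : Set S) (f : (ℕ → S) → ℤ) : Prop :=
  ∃ v, EnsuresPos E A f v ∧ EnsuresPos E Aᶜ (-f) (-v)

/-- Changing the suffix of a sequence to a better one improves the sequence. -/
def PrefixMonotone {S : Type*} (f : (ℕ → S) → ℤ) : Prop :=
  ∀ (k : ℕ) (x y : ℕ → S), (∀ i ≤ k, x i = y i) → f (seqDrop k x) ≤ f (seqDrop k y) → f x ≤ f y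

/-- A sequence is not better than all the simple cycles through its initial state it consists
of, and the suffix from the last visit to that state. -/
def LoopSelective {S : Type*} (f : (ℕ → S) → ℤ) : Prop :=
  ∀ (x : ℕ → S) (m : ℤ),
    (∀ i k, i < k → x i = x 0 → x k = x 0 → (∀ n, i < n → n < k → x n ≠ x 0) →
      f (seqLoop i k x) ≤ m) →
    (∀ k, x k = x 0 → (∀ n, k < n → x n ≠ x 0) → f (seqDrop k x) ≤ m) →
    f x ≤ m

theorem PrefixMonotone.neg {S : Type*} {f : (ℕ → S) → ℤ} (h : PrefixMonotone f) :
    PrefixMonotone (-f) := fun k x y hxy hle =>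
  neg_le_neg (h k y x (fun i hi => (hxy i hi).symm) (neg_le_neg_iff.1 hle))

theorem FollowsPos.followsHist {S : Type*} {A : Set S} {σ : S → S} {x : ℕ → S} (s₀ : S)
    (h : FollowsHist A (fun l => σ (l.headD s₀)) x) : FollowsPos A σ x := by
  intro i hi
  obtain ⟨l, hl⟩ := seqHist_eq_cons x i
  have := h i hi
  rw [hl] at this
  exact this

theorem EnsuresPos.ensuresHist {S : Type*} [Nonempty S] {E : S → S → Prop} {A : Set S}
    {f : (ℕ → S) → ℤ} {v : S → ℤ} (h : EnsuresPos E A f v) : EnsuresHist E A f v := by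
  obtain ⟨σ, hσ, hv⟩ := h
  obtain ⟨s₀⟩ := ‹Nonempty S›
  exact ⟨fun l => σ (l.headD s₀), fun s hs l => hσ s hs,
    fun x hx hf => hv x hx (FollowsPos.followsHist s₀ hf)⟩

/-- Two strategies of opposing players can be played against each other. -/
theorem exists_play {S : Type*} {E : S → S → Prop} {A : Set S} {σ τ : List S → S}
    (hσ : ∀ s ∈ A, ∀ l, E s (σ (s :: l))) (hτ : ∀ s ∈ Aᶜ, ∀ l, E s (τ (s :: l))) (s : S) :
    ∃ x, x 0 = s ∧ IsPath E x ∧ FollowsHist A σ x ∧ FollowsHist Aᶜ τ x := by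
  classical
  let g : S × List S → S := fun p => if p.1 ∈ A then σ (p.1 :: p.2) else τ (p.1 :: p.2)
  let H : ℕ → S × List S := fun n => Nat.rec (s, []) (fun _ p => (g p, p.1 :: p.2)) n
  have hist : ∀ n, seqHist (fun n => (H n).1) n = (H n).1 :: (H n).2 := by
    intro n
    induction n with
    | zero => rfl
    | succ n ih => rw [seqHist, ih]
  have hg : ∀ n, (H (n + 1)).1 = g (H n) := fun _ => rfl
  refine ⟨fun n => (H n).1, rfl, fun i => ?_, fun i hi => ?_, fun i hi => ?_⟩
  · show E (H i).1 (H (i + 1)).1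
    rw [hg]
    by_cases h : (H i).1 ∈ A
    · simpa only [g, h, if_true] using hσ _ h _
    · simpa only [g, h, if_false] using hτ _ h _
  · rw [hist]; exact if_pos hi
  · rw [hist]; exact if_neg hi

/-- Identifies the values obtained from the two players' sides when both have choices. -/
theorem EnsuresHist.le {S : Type*} {E : S → S → Prop} {A : Set S} {f : (ℕ → S) → ℤ}
    {v w : S → ℤ} (h : EnsuresHist E A f v) (h' : EnsuresHist E Aᶜ (-f) (-w)) : v ≤ w := by
  obtain ⟨σ, hσ, hv⟩ := h
  obtain ⟨τ, hτ, hw⟩ := h'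
  intro s
  obtain ⟨x, rfl, hx, hxσ, hxτ⟩ := exists_play hσ hτ s
  exact (hv x hx hxσ).trans (neg_le_neg_iff.1 (hw x hx hxτ))

/-- Forced moves make every path follow the given strategy, so memory is irrelevant. -/
theorem EnsuresHist.ensuresPos {S : Type*} {E : S → S → Prop} {A : Set S} {f : (ℕ → S) → ℤ}
    {v : S → ℤ} (hA : ∀ s ∈ A, ∀ t t', E s t → E s t' → t = t') (h : EnsuresHist E A f v) :
    EnsuresPos E A f v := by
  obtain ⟨σ, hσ, hv⟩ := h
  refine ⟨fun s => σ [s], fun s hs => hσ s hs _, fun x hx _ => hv x hx fun i hi => ?_⟩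
  obtain ⟨l, hl⟩ := seqHist_eq_cons x i
  exact hA _ hi _ _ (hx i) (hl ▸ hσ _ hi l)

/-- In a graph without choices both players have optimal positional strategies. -/
theorem hasPosValue_of_unique {S : Type*} {E : S → S → Prop} (hE : ∀ s, ∃ t, E s t)
    (hu : ∀ s t t', E s t → E s t' → t = t') (A : Set S) (f : (ℕ → S) → ℤ) :
    HasPosValue E A f := by
  choose σ hσ using hE
  have key : ∀ x, IsPath E x → x = fun n => σ^[n] (x 0) := by
    intro x hx
    funext n
    induction n with
    | zero => rfl
    | succ n ih =>
      rw [Function.iterate_succ_apply', ← ih]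
      exact hu _ _ _ (hx n) (hσ _)
  refine ⟨fun s => f fun n => σ^[n] s, ⟨σ, fun s _ => hσ s, fun x hx _ => ?_⟩,
    ⟨σ, fun s _ => hσ s, fun x hx _ => ?_⟩⟩
  · exact (congrArg f (key x hx)).ge
  · exact neg_le_neg (congrArg f (key x hx)).le

/-! ### Splitting the moves at one state -/

/-- The relation `E` with the moves at `s` restricted to the set `U`. -/
def restrictAt {S : Type*} (E : S → S → Prop) (s : S) (U : Set S) (a b : S) : Prop :=
  E a b ∧ (a = s → b ∈ U)

open Classical in
/-- Whether the last move from `s` in a reversed history led to `U`. -/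
noncomputable def lastMoveIn {S : Type*} (s : S) (U : Set S) : List S → Bool
  -- Before any move from `s`, the mode is that of `U`, whose value is the one to be defended.
  | [] => true
  | [_] => true
  | a :: b :: l => if b = s then decide (a ∈ U) else lastMoveIn s U (b :: l)

open Classical in
theorem lastMoveIn_seqHist_succ {S : Type*} (s : S) (U : Set S) (x : ℕ → S) (n : ℕ) :
    lastMoveIn s U (seqHist x (n + 1)) =
      if x n = s then decide (x (n + 1) ∈ U) else lastMoveIn s U (seqHist x n) := by
  obtain ⟨l, hl⟩ := seqHist_eq_cons x n
  rw [seqHist, hl, lastMoveIn]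

theorem lastMoveIn_of_forall_ne {S : Type*} {s : S} (U : Set S) {x : ℕ → S} {n : ℕ}
    (h : ∀ i < n, x i ≠ s) : lastMoveIn s U (seqHist x n) = true := by
  induction n with
  | zero => rfl
  | succ n ih =>
    rw [lastMoveIn_seqHist_succ, if_neg (h n n.lt_succ_self),
      ih fun i hi => h i (hi.trans n.lt_succ_self)]

open Classical in
theorem lastMoveIn_of_last {S : Type*} {s : S} (U : Set S) {x : ℕ → S} {i n : ℕ} (hin : i < n)
    (hi : x i = s) (h : ∀ m, i < m → m < n → x m ≠ s) :
    lastMoveIn s U (seqHist x n) = decide (x (i + 1) ∈ U) := by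
  induction n, hin using Nat.le_induction with
  | base => rw [lastMoveIn_seqHist_succ, if_pos hi]
  | succ n hn ih =>
    rw [lastMoveIn_seqHist_succ, if_neg (h n hn n.lt_succ_self),
      ih fun m hm hmn => h m hm (hmn.trans n.lt_succ_self)]

theorem succ_mod_cases (n p : ℕ) (hp : 0 < p) :
    (n % p + 1 < p ∧ (n + 1) % p = n % p + 1) ∨ (n % p + 1 = p ∧ (n + 1) % p = 0) := by
  have h := Nat.mod_lt n hp
  have h2 : (n + 1) % p = (n % p + 1) % p := by simp
  rcases Nat.lt_or_ge (n % p + 1) p with h1 | h1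
  · exact Or.inl ⟨h1, by rw [h2, Nat.mod_eq_of_lt h1]⟩
  · have h3 : n % p + 1 = p := by omega
    exact Or.inr ⟨h3, by rw [h2, h3, Nat.mod_self]⟩

/-- If every step of a segment between two visits to `x i` satisfies `P`, so does every step
of the periodic repetition of that segment. -/
theorem seqLoop_step {S : Type*} {P : S → S → Prop} {x : ℕ → S} {i k : ℕ} (hik : i < k)
    (hx : x k = x i) (h : ∀ n, i ≤ n → n < k → P (x n) (x (n + 1))) (n : ℕ) :
    P (seqLoop i k x n) (seqLoop i k x (n + 1)) := by
  have hm := Nat.mod_lt n (Nat.sub_pos_of_lt hik)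
  have h0 := h (i + n % (k - i)) (by omega) (by omega)
  unfold seqLoop
  rcases succ_mod_cases n (k - i) (Nat.sub_pos_of_lt hik) with ⟨_, h2⟩ | ⟨h1, h2⟩
  · rw [h2]; exact h0
  · have : i + n % (k - i) + 1 = k := by omega
    rw [this, hx] at h0
    rw [h2]; exact h0

/-- Splitting the moves at a state `s` of the first player: if the restriction of the moves at `s`
to `U` is at least as good at `s` as the restriction to `Uᶜ`, its value is the value of the
unrestricted game. -/
theorem ensures_of_restrictAt {S : Type*} {E : S → S → Prop} {A : Set S} {f : (ℕ → S) → ℤ}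
    (hmono : PrefixMonotone f) (hsel : LoopSelective f) {s : S} (hs : s ∈ A) {U : Set S}
    {v w : S → ℤ} (hwv : w s ≤ v s)
    (hv : EnsuresPos (restrictAt E s U) A f v)
    (hv' : EnsuresPos (restrictAt E s U) Aᶜ (-f) (-v))
    (hw' : EnsuresPos (restrictAt E s Uᶜ) Aᶜ (-f) (-w)) :
    EnsuresPos E A f v ∧ EnsuresHist E Aᶜ (-f) (-v) := by
  classical
  have : Nonempty S := ⟨s⟩
  have hvH := hv.ensuresHist
  obtain ⟨σ, hσ, hσv⟩ := hv
  obtain ⟨τ₁, hτ₁, hτ₁v⟩ := hv'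
  obtain ⟨τ₂, hτ₂, hτ₂w⟩ := hw'
  refine ⟨⟨σ, fun a ha => (hσ a ha).1, fun x hx hxσ => hσv x (fun i => ⟨hx i, fun hi => ?_⟩) hxσ⟩,
    -- The opponent needs one bit of memory: which half was chosen at the last visit to `s`.
    fun l => if lastMoveIn s U l then τ₁ (l.headD s) else τ₂ (l.headD s), fun a ha l => ?_,
    fun x hx hxτ => ?_⟩
  · have his : x i ∈ A := hi ▸ hs
    rw [hxσ i his]
    exact (hσ _ his).2 hi
  · dsimp only
    split_ifs
    · exact (hτ₁ a ha).1
    · exact (hτ₂ a ha).1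
  have hfollow : ∀ n, x n ∈ Aᶜ →
      x (n + 1) = if lastMoveIn s U (seqHist x n) then τ₁ (x n) else τ₂ (x n) := by
    intro n hn
    obtain ⟨l, hl⟩ := seqHist_eq_cons x n
    have := hxτ n hn
    rw [hl] at this ⊢
    exact this
  have hne : ∀ n, x n ∈ Aᶜ → x n ≠ s := fun n hn h => hn (h ▸ hs)
  refine neg_le_neg ?_
  by_cases hvis : ∃ k, x k = s
  swap
  · push Not at hvis
    refine neg_le_neg_iff.1 (hτ₁v x (fun i => ⟨hx i, fun h => (hvis i h).elim⟩) fun i hi => ?_)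
    rw [hfollow i hi, if_pos (lastMoveIn_of_forall_ne U fun n _ => hvis n)]
  set k := Nat.find hvis with hk
  have hks : x k = s := Nat.find_spec hvis
  have hlt : ∀ i < k, x i ≠ s := fun i hi => Nat.find_min hvis hi
  -- one step after a visit to `s` at time `i`
  have hstep : ∀ i n, x i = s → i ≤ n → (∀ m, i < m → m ≤ n → x m ≠ s) →
      if x (i + 1) ∈ U then
        restrictAt E s U (x n) (x (n + 1)) ∧ (x n ∈ Aᶜ → x (n + 1) = τ₁ (x n))
      else
        restrictAt E s Uᶜ (x n) (x (n + 1)) ∧ (x n ∈ Aᶜ → x (n + 1) = τ₂ (x n)) := by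
    intro i n hi hin hm
    rcases hin.eq_or_lt with rfl | hlt
    · split_ifs with hU
      · exact ⟨⟨hx i, fun _ => hU⟩, fun h => (hne i h hi).elim⟩
      · exact ⟨⟨hx i, fun _ => hU⟩, fun h => (hne i h hi).elim⟩
    · have hmode := lastMoveIn_of_last U hlt hi fun m h1 h2 => hm m h1 h2.le
      have hns := hm n hlt le_rfl
      split_ifs with hU
      · refine ⟨⟨hx n, fun h => (hns h).elim⟩, fun h => ?_⟩
        rw [hfollow n h, hmode, if_pos (decide_eq_true hU)]
      · refine ⟨⟨hx n, fun h => (hns h).elim⟩, fun h => ?_⟩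
        rw [hfollow n h, hmode, if_neg (by simpa using hU)]
  -- A play from `s` that stays in one mode belongs to one restricted game, hence is worth at most
  -- `v s` or `w s ≤ v s`.
  have hbound : ∀ y : ℕ → S, y 0 = s → ∀ p : Prop,
      (∀ n, if p then
        restrictAt E s U (y n) (y (n + 1)) ∧ (y n ∈ Aᶜ → y (n + 1) = τ₁ (y n))
      else
        restrictAt E s Uᶜ (y n) (y (n + 1)) ∧ (y n ∈ Aᶜ → y (n + 1) = τ₂ (y n))) →
      f y ≤ v s := by
    intro y hy0 p hy
    by_cases hp : p
    · simp only [hp, if_true] at hy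
      exact hy0 ▸ neg_le_neg_iff.1 (hτ₁v y (fun i => (hy i).1) fun i => (hy i).2)
    · simp only [hp, if_false] at hy
      exact le_trans (hy0 ▸ neg_le_neg_iff.1 (hτ₂w y (fun i => (hy i).1) fun i => (hy i).2)) hwv
  -- The mode is constant between visits to `s`, so each repeated cycle and the final tail is
  -- bounded by `hbound`; selectivity bounds the whole suffix.
  have hdrop : f (seqDrop k x) ≤ v s := by
    have h0 : seqDrop k x 0 = s := hks
    refine hsel _ _ (fun i l hil hi hl hm => ?_) (fun l hl hm => ?_)
    · rw [h0] at hi hl hm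
      refine hbound _ (by simpa [seqLoop] using hi) (x (k + i + 1) ∈ U) fun n => ?_
      refine seqLoop_step (P := fun a b => if x (k + i + 1) ∈ U then
        restrictAt E s U a b ∧ (a ∈ Aᶜ → b = τ₁ a)
        else restrictAt E s Uᶜ a b ∧ (a ∈ Aᶜ → b = τ₂ a)) hil (hl.trans hi.symm)
        (fun n h1 h2 => ?_) n
      refine hstep (k + i) (k + n) hi (by omega) fun m h3 h4 => ?_
      have := hm (m - k) (by omega) (by omega)
      rwa [seqDrop, Nat.add_sub_of_le (by omega)] at this
    · rw [h0] at hl hm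
      refine hbound _ hl (x (k + l + 1) ∈ U) fun n => ?_
      have := hstep (k + l) (k + l + n) hl (by omega) fun m h3 h4 => by
        have := hm (m - k) (by omega)
        rwa [seqDrop, Nat.add_sub_of_le (by omega)] at this
      simpa only [seqDrop, add_assoc] using this
  -- The suffix after the first visit to `s` is replaced by an optimal play `y` of the `U`-game,
  -- worth at least `v s`. The resulting `z` lies wholly in that game and follows `τ₁`, so `f x ≤ f
  -- z ≤ v (x 0)`.
  obtain ⟨σ', hσ', hσv'⟩ := hvH
  obtain ⟨y, hy0, hyE, hyσ, hyτ⟩ := exists_play hσ'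
    (τ := fun l => τ₁ (l.headD s)) (fun a ha l => hτ₁ a ha) s
  have hyv : v s ≤ f y := hy0 ▸ hσv' y hyE hyσ
  have hyτ' := FollowsPos.followsHist s hyτ
  let z : ℕ → S := fun n => if n < k then x n else y (n - k)
  have hz : ∀ n ≤ k, z n = x n := by
    intro n hn
    rcases hn.lt_or_eq with h | rfl
    · exact if_pos h
    · simp only [z, lt_irrefl, if_false, Nat.sub_self, hy0, hks]
  have hzd : ∀ n, z (k + n) = y n := fun n => by simp [z]
  have hzx : f x ≤ f z := by
    refine hmono k x z (fun i hi => (hz i hi).symm) ?_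
    have : seqDrop k z = y := funext hzd
    rw [this]
    exact hdrop.trans hyv
  have hzstep : ∀ n, restrictAt E s U (z n) (z (n + 1)) ∧ (z n ∈ Aᶜ → z (n + 1) = τ₁ (z n)) := by
    intro n
    rcases Nat.lt_or_ge n k with h | h
    · rw [hz n h.le, hz (n + 1) h]
      refine ⟨⟨hx n, fun h' => (hlt n h h').elim⟩, fun h' => ?_⟩
      rw [hfollow n h', if_pos (lastMoveIn_of_forall_ne U fun i hi => hlt i (hi.trans h))]
    · obtain ⟨m, rfl⟩ := Nat.exists_eq_add_of_le h
      rw [add_assoc, hzd, hzd]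
      exact ⟨hyE m, hyτ' m⟩
  have := neg_le_neg_iff.1 (hτ₁v z (fun n => (hzstep n).1) fun n => (hzstep n).2)
  exact hzx.trans (this.trans_eq (congrArg v (hz 0 (Nat.zero_le _))))

theorem restrictAt_total {S : Type*} {E : S → S → Prop} (hE : ∀ a, ∃ b, E a b) {s t : S}
    {U : Set S} (ht : E s t) (htU : t ∈ U) (a : S) : ∃ b, restrictAt E s U a b := by
  by_cases ha : a = s
  · exact ⟨t, ha ▸ ht, fun _ => htU⟩
  · obtain ⟨b, hb⟩ := hE a
    exact ⟨b, hb, fun h => (ha h).elim⟩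

theorem ncard_restrictAt_lt {S : Type*} [Finite S] {E : S → S → Prop} {s t : S} {U : Set S}
    (ht : E s t) (htU : t ∉ U) :
    {p : S × S | restrictAt E s U p.1 p.2}.ncard < {p : S × S | E p.1 p.2}.ncard := by
  refine Set.ncard_lt_ncard ⟨fun p hp => hp.1, fun h => ?_⟩ (Set.toFinite _)
  exact htU ((h (show (s, t) ∈ {p : S × S | E p.1 p.2} from ht)).2 rfl)

/-- At a state with a choice for the first player, one of the two restrictions is optimal. -/
theorem exists_ensures_of_split {S : Type*} {E : S → S → Prop} {A : Set S} {f : (ℕ → S) → ℤ}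
    (hmono : PrefixMonotone f) (hsel : LoopSelective f) {s : S} (hs : s ∈ A) {U : Set S}
    (h : HasPosValue (restrictAt E s U) A f) (h' : HasPosValue (restrictAt E s Uᶜ) A f) :
    ∃ v, EnsuresPos E A f v ∧ EnsuresHist E Aᶜ (-f) (-v) := by
  obtain ⟨v, hv, hv'⟩ := h
  obtain ⟨w, hw, hw'⟩ := h'
  rcases le_total (w s) (v s) with hle | hle
  · exact ⟨v, ensures_of_restrictAt hmono hsel hs hle hv hv' hw'⟩
  · exact ⟨w, ensures_of_restrictAt hmono hsel hs hle hw hw' (by rwa [compl_compl])⟩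

theorem HasPosValue.neg {S : Type*} {E : S → S → Prop} {A : Set S} {f : (ℕ → S) → ℤ}
    (h : HasPosValue E A f) : HasPosValue E Aᶜ (-f) := by
  obtain ⟨v, hv, hv'⟩ := h
  exact ⟨-v, hv', by rwa [compl_compl, neg_neg, neg_neg]⟩

/-- Positional determinacy of finite games with a payoff that is prefix monotone and selective
for both players. -/
theorem hasPosValue_of_loopSelective {S : Type*} [Finite S] [Nonempty S] {A : Set S} {f : (ℕ → S) → ℤ}
    (hmono : PrefixMonotone f) (hsel : LoopSelective f) (hsel' : LoopSelective (-f))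
    (E : S → S → Prop) (hE : ∀ s, ∃ t, E s t) : HasPosValue E A f := by
  induction hn : {p : S × S | E p.1 p.2}.ncard using Nat.strong_induction_on generalizing E with
  | _ n ih =>
  subst hn
  -- Each half loses an edge, `t'` or `t` respectively, and remains total.
  have hsplit : ∀ s t t', E s t → E s t' → t ≠ t' →
      HasPosValue (restrictAt E s {t}) A f ∧ HasPosValue (restrictAt E s {t}ᶜ) A f := by
    intro s t t' ht ht' hne
    exact ⟨ih _ (ncard_restrictAt_lt ht' fun h => hne h.symm) _ (restrictAt_total hE ht rfl) rfl,
      ih _ (ncard_restrictAt_lt ht fun h : t ∈ ({t}ᶜ : Set S) => h rfl) _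
        (restrictAt_total hE ht' fun h => hne h.symm) rfl⟩
  have hA : (∀ s ∈ A, ∀ t t', E s t → E s t' → t = t') ∨
      ∃ v, EnsuresPos E A f v ∧ EnsuresHist E Aᶜ (-f) (-v) := by
    by_cases h : ∀ s ∈ A, ∀ t t', E s t → E s t' → t = t'
    · exact Or.inl h
    · push Not at h
      obtain ⟨s, hs, t, t', ht, ht', hne⟩ := h
      obtain ⟨h1, h2⟩ := hsplit s t t' ht ht' hne
      exact Or.inr (exists_ensures_of_split hmono hsel hs h1 h2)
  have hB : (∀ s ∈ Aᶜ, ∀ t t', E s t → E s t' → t = t') ∨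
      ∃ v, EnsuresPos E Aᶜ (-f) (-v) ∧ EnsuresHist E A f v := by
    by_cases h : ∀ s ∈ Aᶜ, ∀ t t', E s t → E s t' → t = t'
    · exact Or.inl h
    · push Not at h
      obtain ⟨s, hs, t, t', ht, ht', hne⟩ := h
      obtain ⟨h1, h2⟩ := hsplit s t t' ht ht' hne
      obtain ⟨v, h3, h4⟩ := exists_ensures_of_split hmono.neg hsel' hs h1.neg h2.neg
      rw [compl_compl, neg_neg] at h4
      exact Or.inr ⟨-v, by rwa [neg_neg], h4⟩
  -- A split yields a positional optimum only for the player with the choice. The other side comes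
  -- from its own split, or from having no choices at all.
  rcases hA with hA | ⟨v, hv, hv'⟩ <;> rcases hB with hB | ⟨w, hw, hw'⟩
  · refine hasPosValue_of_unique hE (fun s => ?_) A f
    by_cases hs : s ∈ A
    · exact hA s hs
    · exact hB s hs
  · exact ⟨w, hw'.ensuresPos hA, hw⟩
  · exact ⟨v, hv, hv'.ensuresPos hB⟩
  · have : v = w := le_antisymm (hv.ensuresHist.le hw.ensuresHist) (hw'.le hv')
    exact ⟨v, hv, this ▸ hw⟩

/-! ### The payoff of a parity game -/

/-- Sequences of colors have a greatest color occurring infinitely often. -/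
theorem exists_isGreatest_infColors {π : ℕ → ℕ} {d : ℕ} (h : ∀ i, π i ≤ d) :
    ∃ e, IsGreatest (infColors π) e := by
  have hbdd : ∀ e ∈ infColors π, e ≤ d := by
    intro e he
    obtain ⟨i, hi⟩ := Filter.Frequently.exists he
    exact hi ▸ h i
  have hne : (infColors π).Nonempty := by
    by_contra hemp
    have h1 : ∀ e ∈ Set.Iic d, ∀ᶠ i in atTop, π i ≠ e := fun e _ => by
      by_contra hc
      exact hemp ⟨e, hc⟩
    have h2 := (Filter.eventually_all_finite (Set.finite_Iic d)).2 h1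
    obtain ⟨i, hi⟩ := h2.exists
    exact hi (π i) (h i) rfl
  exact ⟨sSup (infColors π), Nat.sSup_mem hne ⟨d, hbdd⟩, fun e he => le_csSup ⟨d, hbdd⟩ he⟩

theorem exists_isGreatest_image {π : ℕ → ℕ} {d : ℕ} (h : ∀ i, π i ≤ d) :
    ∃ m, IsGreatest (π '' {i | 0 < i}) m := by
  have hb : BddAbove (π '' {i | 0 < i}) := ⟨d, by rintro _ ⟨i, -, rfl⟩; exact h i⟩
  have hne : (π '' {i | 0 < i}).Nonempty := ⟨π 1, 1, Nat.one_pos, rfl⟩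
  exact ⟨_, Nat.sSup_mem hne hb, fun e he => le_csSup hb he⟩

/-- `1` or `-1`, depending on whether `n` has the parity of the player `j`. -/
def paritySign (j : Fin 2) (n : ℕ) : ℤ := if n % 2 = (j : ℕ) then 1 else -1

theorem paritySign_sub (j : Fin 2) (n : ℕ) : paritySign (1 - j) n = -paritySign j n := by
  unfold paritySign
  fin_cases j
  · have : ((1 - 0 : Fin 2) : ℕ) = 1 := rfl
    simp only [Fin.zero_eta, this]
    split_ifs <;> omega
  · have : ((1 - 1 : Fin 2) : ℕ) = 0 := rfl
    simp only [Fin.mk_one, this]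
    split_ifs <;> omega

theorem modEq_player_iff (j : Fin 2) (n : ℕ) : n ≡ (j : ℕ) [MOD 2] ↔ n % 2 = (j : ℕ) := by
  rw [Nat.ModEq, Nat.mod_eq_of_lt j.isLt]

/-- The payoff of a sequence of colors for player `j`: first the parity of the greatest color
occurring infinitely often counts, then the greatest non-initial color. -/
noncomputable def parityPayoff (j : Fin 2) (d : ℕ) (π : ℕ → ℕ) : ℤ :=
  paritySign j (sSup (infColors π)) * (2 * d + 2) +
    paritySign j (sSup (π '' {i | 0 < i})) * (sSup (π '' {i | 0 < i}) : ℕ)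

theorem parityPayoff_eq (j : Fin 2) (d : ℕ) {π : ℕ → ℕ} {e m : ℕ} (he : IsGreatest (infColors π) e)
    (hm : IsGreatest (π '' {i | 0 < i}) m) :
    parityPayoff j d π = paritySign j e * (2 * d + 2) + paritySign j m * m := by
  rw [parityPayoff, he.csSup_eq, hm.csSup_eq]

theorem parityPayoff_sub (j : Fin 2) (d : ℕ) (π : ℕ → ℕ) :
    parityPayoff (1 - j) d π = -parityPayoff j d π := by
  simp only [parityPayoff, paritySign_sub]
  ring

theorem mem_parityObjective_iff (j : Fin 2) {d : ℕ} {π : ℕ → ℕ} (h : ∀ i, π i ≤ d) :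
    π ∈ parityObjective j ↔ 0 < parityPayoff j d π := by
  obtain ⟨e, he⟩ := exists_isGreatest_infColors h
  obtain ⟨m, hm⟩ := exists_isGreatest_image h
  have hmd : m ≤ d := by obtain ⟨i, -, rfl⟩ := hm.1; exact h i
  have : π ∈ parityObjective j ↔ e % 2 = (j : ℕ) := by
    rw [← modEq_player_iff]
    refine ⟨fun ⟨_, e', he', hj⟩ => he.unique he' ▸ hj, fun hj => ⟨⟨d, h⟩, e, he, hj⟩⟩
  rw [this, parityPayoff_eq j d he hm]
  unfold paritySign
  split_ifs <;> simp only [*, true_iff, false_iff] <;> omega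

/-- Colors are at least 1, so the second term is nonzero and its sign shows on which side of `2d+2`
the payoff falls. -/
theorem mem_coreObjective_iff (j : Fin 2) {d : ℕ} {π : ℕ → ℕ} (h : ∀ i, π i ∈ Finset.Icc 1 d) :
    π ∈ coreObjective j ↔ (2 * d + 2 : ℤ) < parityPayoff j d π := by
  have h' : ∀ i, π i ≤ d := fun i => (Finset.mem_Icc.1 (h i)).2
  obtain ⟨e, he⟩ := exists_isGreatest_infColors h'
  obtain ⟨m, hm⟩ := exists_isGreatest_image h'
  have hmd : 1 ≤ m ∧ m ≤ d := by obtain ⟨i, -, rfl⟩ := hm.1; exact Finset.mem_Icc.1 (h i)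
  have : π ∈ coreObjective j ↔ 0 < parityPayoff j d π ∧ m % 2 = (j : ℕ) := by
    rw [← modEq_player_iff, ← mem_parityObjective_iff j h']
    exact and_congr_right fun _ =>
      ⟨fun ⟨m', hm', hj⟩ => hm.unique hm' ▸ hj, fun hj => ⟨m, hm, hj⟩⟩
  rw [this, parityPayoff_eq j d he hm]
  unfold paritySign
  split_ifs <;> simp only [*, and_true, and_false, false_iff] <;> omega

/-! ### Prefix monotonicity of the parity payoff -/

theorem infColors_seqDrop (k : ℕ) (π : ℕ → ℕ) : infColors (seqDrop k π) = infColors π := by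
  ext e
  simp only [infColors, Set.mem_ofPred_eq, seqDrop, Filter.frequently_atTop]
  constructor
  · intro h a
    obtain ⟨b, hb, hbe⟩ := h a
    exact ⟨k + b, by omega, hbe⟩
  · intro h a
    obtain ⟨b, hb, hbe⟩ := h (k + a)
    exact ⟨b - k, by omega, by rwa [Nat.add_sub_of_le (by omega)]⟩

theorem isGreatest_of_seqDrop {π : ℕ → ℕ} {k m : ℕ}
    (hm : IsGreatest (seqDrop k π '' {i | 0 < i}) m) :
    IsGreatest (π '' {i | 0 < i}) (max ((Finset.Icc 1 k).sup π) m) := by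
  constructor
  · rcases le_total ((Finset.Icc 1 k).sup π) m with h | h
    · rw [max_eq_right h]
      obtain ⟨i, hi, rfl⟩ := hm.1
      exact ⟨k + i, Nat.add_pos_right k hi, rfl⟩
    · rw [max_eq_left h]
      rcases Nat.eq_zero_or_pos k with rfl | hk
      · have : m = 0 := by simpa using h
        obtain ⟨i, hi, h'⟩ := hm.1
        exact ⟨i, hi, by simpa [seqDrop, this] using h'⟩
      · obtain ⟨i, hi, h'⟩ := Finset.exists_mem_eq_sup (Finset.Icc 1 k)
          ⟨1, Finset.mem_Icc.2 ⟨le_rfl, hk⟩⟩ π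
        exact ⟨i, (Finset.mem_Icc.1 hi).1, h'.symm⟩
  · rintro _ ⟨i, hi, rfl⟩
    rcases Nat.lt_or_ge k i with h | h
    · refine le_max_of_le_right (hm.2 ⟨i - k, Nat.sub_pos_of_lt h, ?_⟩)
      simp only [seqDrop, Nat.add_sub_of_le h.le]
    · exact le_max_of_le_left (Finset.le_sup (f := π) (Finset.mem_Icc.2 ⟨hi, h⟩))

/-- A common prefix leaves the first term unchanged and replaces `m` by `max P m`. The order of
colors by signed size is preserved by this map; the order by parity alone would not be, which is why
the payoff records the size of `m`. -/
theorem prefixMonotone_parityPayoff {S : Type*} (j : Fin 2) {d : ℕ} {c : S → ℕ}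
    (hc : ∀ s, c s ≤ d) : PrefixMonotone fun x => parityPayoff j d (c ∘ x) := by
  intro k x y hxy hle
  obtain ⟨e, he⟩ := exists_isGreatest_infColors (π := seqDrop k (c ∘ x)) fun i => hc _
  obtain ⟨e', he'⟩ := exists_isGreatest_infColors (π := seqDrop k (c ∘ y)) fun i => hc _
  obtain ⟨m, hm⟩ := exists_isGreatest_image (π := seqDrop k (c ∘ x)) fun i => hc _
  obtain ⟨m', hm'⟩ := exists_isGreatest_image (π := seqDrop k (c ∘ y)) fun i => hc _
  have hmd : m ≤ d := by obtain ⟨i, -, rfl⟩ := hm.1; exact hc _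
  have hmd' : m' ≤ d := by obtain ⟨i, -, rfl⟩ := hm'.1; exact hc _
  have hP : (Finset.Icc 1 k).sup (c ∘ x) = (Finset.Icc 1 k).sup (c ∘ y) :=
    Finset.sup_congr rfl fun i hi => congrArg c (hxy i (Finset.mem_Icc.1 hi).2)
  have hPd : (Finset.Icc 1 k).sup (c ∘ x) ≤ d := Finset.sup_le fun i _ => hc _
  have hle' : parityPayoff j d (seqDrop k (c ∘ x)) ≤ parityPayoff j d (seqDrop k (c ∘ y)) := hle
  rw [parityPayoff_eq j d he hm, parityPayoff_eq j d he' hm'] at hle'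
  rw [infColors_seqDrop] at he he'
  show parityPayoff j d (c ∘ x) ≤ parityPayoff j d (c ∘ y)
  rw [parityPayoff_eq j d he (isGreatest_of_seqDrop hm),
    parityPayoff_eq j d he' (isGreatest_of_seqDrop hm'), ← hP]
  generalize (Finset.Icc 1 k).sup (c ∘ x) = P at *
  clear hle he he' hm hm' hP
  generalize hn : max P m = n
  generalize hn' : max P m' = n'
  unfold paritySign at *
  split_ifs at * <;> omega

/-! ### Selectivity of the parity payoff -/

theorem frequently_seqLoop {S : Type*} {x : ℕ → S} {i k n : ℕ} (hin : i ≤ n) (hnk : n < k) :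
    ∃ᶠ m in atTop, seqLoop i k x m = x n := by
  rw [Filter.frequently_atTop]
  intro a
  refine ⟨(n - i) + (k - i) * a, ?_, ?_⟩
  · have := Nat.le_mul_of_pos_left a (show 0 < k - i by omega)
    omega
  · rw [seqLoop, Nat.add_mul_mod_self_left, Nat.mod_eq_of_lt (by omega), Nat.add_sub_of_le hin]

/-- On the repetition of a segment, the greatest color is the greatest one of the segment. -/
theorem parityPayoff_seqLoop (j : Fin 2) (d : ℕ) {π : ℕ → ℕ} {i k n : ℕ} (hin : i ≤ n) (hnk : n < k)
    (hmax : ∀ l, i ≤ l → l < k → π l ≤ π n) :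
    parityPayoff j d (seqLoop i k π) =
      paritySign j (π n) * (2 * d + 2) + paritySign j (π n) * π n := by
  have hle : ∀ m, seqLoop i k π m ≤ π n := fun m => by
    have := Nat.mod_lt m (show 0 < k - i by omega)
    exact hmax _ (by omega) (by omega)
  have hfr := frequently_seqLoop (x := π) hin hnk
  refine parityPayoff_eq j d ⟨hfr, fun e he => ?_⟩ ⟨?_, ?_⟩
  · obtain ⟨m, rfl⟩ := Filter.Frequently.exists he
    exact hle m
  · obtain ⟨m, hm, hm'⟩ := Filter.frequently_atTop.1 hfr 1
    exact ⟨m, hm, hm'⟩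
  · rintro _ ⟨m, -, rfl⟩
    exact hle m

/-- A position in between two visits lies in a simple cycle. -/
theorem exists_simple_cycle {S : Type*} (x : ℕ → S) {n N : ℕ} (hnN : n < N) (hN : x N = x 0) :
    ∃ i k, i ≤ n ∧ n < k ∧ x i = x 0 ∧ x k = x 0 ∧ ∀ m, i < m → m < k → x m ≠ x 0 := by
  classical
  have hex : ∃ k, n < k ∧ x k = x 0 := ⟨N, hnN, hN⟩
  have h1 := Nat.findGreatest_spec (P := fun i => x i = x 0) (Nat.zero_le n) rfl
  refine ⟨Nat.findGreatest (fun i => x i = x 0) n, Nat.find hex, Nat.findGreatest_le n,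
    (Nat.find_spec hex).1, h1, (Nat.find_spec hex).2, fun m hm hm' h => ?_⟩
  rcases Nat.lt_or_ge n m with h2 | h2
  · exact Nat.find_min hex hm' ⟨h2, h⟩
  · exact Nat.findGreatest_is_greatest hm h2 h

/-- If `m` has good parity and lies in a cycle, repeating that cycle is at least as good as `x`. If
its parity is bad, `m` only hurts: a late cycle with maximum `e`, the tail, or, when `e` is bad too,
the cycle of `m` itself does no worse. -/
theorem loopSelective_parityPayoff {S : Type*} (j : Fin 2) {d : ℕ} {c : S → ℕ}
    (hc : ∀ s, c s ≤ d) : LoopSelective fun x => parityPayoff j d (c ∘ x) := by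
  intro x b hloop htail
  obtain ⟨e, he⟩ := exists_isGreatest_infColors (π := c ∘ x) fun i => hc _
  obtain ⟨m, hm⟩ := exists_isGreatest_image (π := c ∘ x) fun i => hc _
  have hmd : m ≤ d := by obtain ⟨i, -, rfl⟩ := hm.1; exact hc _
  have hem : e ≤ m := by
    obtain ⟨i, hi, hi'⟩ := Filter.frequently_atTop.1 he.1 1
    exact hm.2 ⟨i, hi, hi'⟩
  show parityPayoff j d (c ∘ x) ≤ b
  rw [parityPayoff_eq j d he hm]
  have hcyc : ∀ V p N, V ≤ p → p < N → x V = x 0 → x N = x 0 →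
      (∀ l, V ≤ l → c (x l) ≤ c (x p)) →
      paritySign j (c (x p)) * (2 * d + 2) + paritySign j (c (x p)) * c (x p) ≤ b := by
    intro V p N hVp hpN hV hN hmax
    obtain ⟨i, k, hip, hpk, hi, hk, hno⟩ := exists_simple_cycle x hpN hN
    -- The cycle cannot begin before the visit `V`, so a bound on the colors from `V` on covers it.
    have hVi : V ≤ i := by
      by_contra h
      exact hno V (by omega) (by omega) hV
    refine (parityPayoff_seqLoop j d (π := c ∘ x) hip hpk
      fun l hl _ => hmax l (hVi.trans hl)).symm.trans_le ?_
    exact hloop i k (hip.trans_lt hpk) hi hk fun n h1 h2 => hno n h1 h2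
  -- the greatest color, if it occurs before some later visit
  have hmcyc : ∀ p N, p < N → x N = x 0 → c (x p) = m →
      paritySign j m * (2 * d + 2) + paritySign j m * m ≤ b := by
    rintro p N hpN hN rfl
    refine hcyc 0 p N (Nat.zero_le _) hpN rfl hN fun l _ => ?_
    rcases Nat.eq_zero_or_pos l with rfl | hl
    -- Position 0 does not count towards `m`, but its state recurs at `N`.
    · exact hN ▸ hm.2 ⟨N, (Nat.zero_le p).trans_lt hpN, rfl⟩
    · exact hm.2 ⟨l, hl, rfl⟩
  obtain ⟨p, hp, hpm⟩ := hm.1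
  have hp : 0 < p := hp
  have hpm : c (x p) = m := hpm
  by_cases hinf : ∀ n, ∃ N, n < N ∧ x N = x 0
  · obtain ⟨N, hpN, hN⟩ := hinf p
    have h1 := hmcyc p N hpN hN hpm
    have hev : ∀ᶠ i in atTop, c (x i) ≤ e := by
      have h2 : ∀ a ∈ Set.Iic d, ∀ᶠ i in atTop, e < a → c (x i) ≠ a := fun a _ => by
        by_contra hcon
        simp only [Filter.not_eventually, Classical.not_imp, not_not] at hcon
        have hea : e < a := hcon.exists.elim fun _ h => h.1
        exact absurd (he.2 (hcon.mono fun _ h => h.2)) (not_le.2 hea)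
      filter_upwards [(Filter.eventually_all_finite (Set.finite_Iic d)).2 h2] with i hi
      by_contra hcon
      exact hi (c (x i)) (hc _) (not_le.1 hcon) rfl
    obtain ⟨T, hT⟩ := Filter.eventually_atTop.1 hev
    obtain ⟨V, hTV, hV⟩ := hinf T
    obtain ⟨q, hVq, hq⟩ := Filter.frequently_atTop.1 he.1 V
    have hq : c (x q) = e := hq
    obtain ⟨M, hqM, hM⟩ := hinf q
    -- After `T` no color exceeds `e`, so `e` is the maximum of a late cycle.
    have h2 := hcyc V q M hVq hqM hV hM fun l hl => hq ▸ hT l (hTV.le.trans hl)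
    rw [hq] at h2
    clear hcyc hmcyc hloop htail
    unfold paritySign at *
    split_ifs at * <;> omega
  · push Not at hinf
    obtain ⟨B, hB⟩ := hinf
    classical
    set k := Nat.findGreatest (fun i => x i = x 0) B with hkdef
    have hk : x k = x 0 := Nat.findGreatest_spec (P := fun i => x i = x 0) (Nat.zero_le B) rfl
    have hlast : ∀ n, k < n → x n ≠ x 0 := fun n hn => by
      rcases Nat.lt_or_ge B n with h | h
      · exact hB n h
      · exact Nat.findGreatest_is_greatest hn h
    obtain ⟨t, ht⟩ := exists_isGreatest_image (π := seqDrop k (c ∘ x)) fun i => hc _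
    have h1 : parityPayoff j d (seqDrop k (c ∘ x)) ≤ b := htail k hk hlast
    rw [parityPayoff_eq j d ((infColors_seqDrop k (c ∘ x)).symm ▸ he) ht] at h1
    have htm : t ≤ m := by
      rw [hm.unique (isGreatest_of_seqDrop ht)]
      exact le_max_right _ _
    have h2 : m = t ∨ paritySign j m * (2 * d + 2) + paritySign j m * m ≤ b := by
      rcases lt_trichotomy p k with h | h | h
      · exact Or.inr (hmcyc p k h hk hpm)
      -- Here `m` is the color of `x 0` itself, which position 0 already contributes to the first
      -- cycle.
      · exact Or.inr (hmcyc 0 k (h ▸ hp) hk (by rw [← hk, ← h, hpm]))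
      · refine Or.inl (le_antisymm (ht.2 ⟨p - k, Nat.sub_pos_of_lt h, ?_⟩) htm)
        simp only [seqDrop, Nat.add_sub_of_le h.le, Function.comp, hpm]
    rcases h2 with rfl | h2
    · exact h1
    clear hcyc hmcyc hloop htail
    unfold paritySign at *
    split_ifs at * <;> omega

/-! ### Positional strategies in parity games -/

namespace ParityGame

variable {S : Type*} {G : ParityGame S}

theorem owned_one_sub (G : ParityGame S) (j : Fin 2) : G.owned (1 - j) = (G.owned j)ᶜ := by
  have h : IsCompl (G.owned 0) (G.owned 1) :=
    ⟨Set.disjoint_iff_inter_eq_empty.2 G.owned_inter, codisjoint_iff.2 G.owned_union⟩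
  fin_cases j
  · exact h.compl_eq.symm
  · exact h.symm.compl_eq.symm

/-- The memoryless strategy given by a choice of a successor of every state of player `j`. -/
def positionalStrategy {j : Fin 2} (σ : S → S) (hσ : ∀ s ∈ G.owned j, G.R s (σ s)) :
    G.Strategy j where
  move h _ := σ h.last
  move_mem h hj := hσ h.last hj

theorem positionalStrategy_isMemoryless {j : Fin 2} (σ : S → S)
    (hσ : ∀ s ∈ G.owned j, G.R s (σ s)) : (positionalStrategy σ hσ).IsMemoryless :=
  fun _ _ _ _ h => congrArg σ h

theorem followsPos_of_compatible {j : Fin 2} {σ : S → S} {hσ : ∀ s ∈ G.owned j, G.R s (σ s)}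
    {ρ : ℕ → S} {hρ : G.IsPlay ρ} (h : (positionalStrategy σ hσ).Compatible hρ) :
    FollowsPos (G.owned j) σ ρ := fun i hi => by
  have := h i hi
  rw [← this]
  exact congrArg σ (hρ.last_take i)

theorem History.last_eq_of_states_eq {h : G.History} {s : S} {l : List S}
    (e : h.states = (s :: l).reverse) : h.last = s := by
  cases h
  subst e
  simp [History.last]

open Classical in
/-- A strategy as a function on reversed lists of states. -/
noncomputable def Strategy.onList {j : Fin 2} (σ : G.Strategy j) (s₀ : S) (l : List S) : S :=
  if h : ∃ h : G.History, h.states = l.reverse ∧ h.last ∈ G.owned j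
  then σ.move h.choose h.choose_spec.2
  -- An arbitrary successor on lists that are not histories ending at a state of `j`.
  else (G.R_total (l.headD s₀)).choose

theorem Strategy.onList_mem {j : Fin 2} (σ : G.Strategy j) (s₀ s : S) (l : List S) :
    G.R s (σ.onList s₀ (s :: l)) := by
  unfold Strategy.onList
  split_ifs with h
  · exact (congrArg (fun a => G.R a (σ.move h.choose h.choose_spec.2))
      (History.last_eq_of_states_eq h.choose_spec.1)).mp (σ.move_mem _ _)
  · exact (G.R_total s).choose_spec

theorem History.eq_of_states_eq {h h' : G.History} (e : h.states = h'.states) : h = h' := by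
  cases h; cases h'; congr

theorem Strategy.compatible_of_followsHist {j : Fin 2} (σ : G.Strategy j) {s₀ : S} {ρ : ℕ → S}
    (hρ : G.IsPlay ρ) (h : FollowsHist (G.owned j) (σ.onList s₀) ρ) : σ.Compatible hρ := by
  intro i hi
  rw [h i hi]
  have hex : ∃ h : G.History, h.states = (seqHist ρ i).reverse ∧ h.last ∈ G.owned j :=
    ⟨hρ.take i, (seqHist_reverse ρ i).symm, (hρ.last_take i).symm ▸ hi⟩
  rw [Strategy.onList, dif_pos hex]
  have heq : hρ.take i = hex.choose :=
    History.eq_of_states_eq ((seqHist_reverse ρ i).symm.trans hex.choose_spec.1.symm)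
  congr 1

end ParityGame

/-! ### From the value to the three claims -/

theorem mainTheorem2 {S : Type*} (G : ParityGame S) (j : Fin 2) :
    ∃ σ : G.Strategy j, σ.IsMemoryless ∧
      (∀ s ∈ G.winningCore j, G.colorSeq '' σ.playsFrom s ⊆ coreObjective j) ∧
      (∀ s ∈ G.winningRegion j, G.colorSeq '' σ.playsFrom s ⊆ parityObjective j) ∧
      (∀ s ∉ G.winningCore (1 - j),
        G.colorSeq '' σ.playsFrom s ∩ coreObjective (1 - j) = ∅) := by
  rcases isEmpty_or_nonempty S with hS | hS
  · exact ⟨ParityGame.positionalStrategy id fun s => hS.elim s,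
      ParityGame.positionalStrategy_isMemoryless _ _, fun s => hS.elim s, fun s => hS.elim s,
      fun s => hS.elim s⟩
  have := G.finite_states
  let f : (ℕ → S) → ℤ := fun ρ => parityPayoff j G.d (G.color ∘ ρ)
  have hc : ∀ s, G.color s ≤ G.d := fun s => (Finset.mem_Icc.1 (G.color_mem s)).2
  have hneg : (fun ρ => parityPayoff (1 - j) G.d (G.color ∘ ρ)) = -f :=
    funext fun ρ => parityPayoff_sub _ _ _
  have hΩ : ∀ ρ, G.colorSeq ρ ∈ parityObjective j ↔ 0 < f ρ :=
    fun ρ => mem_parityObjective_iff j fun i => hc (ρ i)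
  have hΛ : ∀ ρ, G.colorSeq ρ ∈ coreObjective j ↔ (2 * G.d + 2 : ℤ) < f ρ :=
    fun ρ => mem_coreObjective_iff j fun i => G.color_mem (ρ i)
  have hΛ' : ∀ ρ, G.colorSeq ρ ∈ coreObjective (1 - j) ↔ (2 * G.d + 2 : ℤ) < -f ρ := fun ρ =>
    (mem_coreObjective_iff (1 - j) fun i => G.color_mem (ρ i)).trans
      (iff_of_eq (congrArg (fun z : ℤ => (2 * G.d + 2 : ℤ) < z) (congrFun hneg ρ)))
  obtain ⟨v, ⟨σ, hσ, hσv⟩, τ, hτ, hτv⟩ := hasPosValue_of_loopSelective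
    (A := G.owned j) (f := f) (prefixMonotone_parityPayoff j hc) (loopSelective_parityPayoff j hc)
    (hneg ▸ loopSelective_parityPayoff (1 - j) hc) G.R G.R_total
  have hplay : ∀ s, ∀ ρ ∈ (ParityGame.positionalStrategy σ hσ).playsFrom s, v s ≤ f ρ := by
    rintro s ρ ⟨rfl, hρ, hcomp⟩
    exact hσv ρ hρ (ParityGame.followsPos_of_compatible hcomp)
  -- no strategy achieves more than the value
  have hopt : ∀ (σ' : G.Strategy j) (s : S), ∃ ρ ∈ σ'.playsFrom s, f ρ ≤ v s := by
    intro σ' s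
    obtain ⟨ρ, h0, hρ, hρσ, hρτ⟩ := exists_play (A := G.owned j)
      (fun a _ l => σ'.onList_mem s a l) (τ := fun l => τ (l.headD s)) (fun a ha l => hτ a ha) s
    refine ⟨ρ, ⟨h0, hρ, σ'.compatible_of_followsHist hρ hρσ⟩, ?_⟩
    exact h0 ▸ neg_le_neg_iff.1 (hτv ρ hρ (FollowsPos.followsHist s hρτ))
  refine ⟨ParityGame.positionalStrategy σ hσ, ParityGame.positionalStrategy_isMemoryless σ hσ,
    ?_, ?_, ?_⟩
  · rintro s ⟨σ', hσ'⟩ _ ⟨ρ, hρ, rfl⟩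
    obtain ⟨ρ', hρ', hle⟩ := hopt σ' s
    exact (hΛ ρ).2 ((((hΛ ρ').1 (hσ' ⟨ρ', hρ', rfl⟩)).trans_le hle).trans_le (hplay s ρ hρ))
  · rintro s ⟨σ', hσ'⟩ _ ⟨ρ, hρ, rfl⟩
    obtain ⟨ρ', hρ', hle⟩ := hopt σ' s
    exact (hΩ ρ).2 ((((hΩ ρ').1 (hσ' ⟨ρ', hρ', rfl⟩)).trans_le hle).trans_le (hplay s ρ hρ))
  · intro s hs
    rw [Set.eq_empty_iff_forall_notMem]
    rintro _ ⟨⟨ρ, hρ, rfl⟩, hmem⟩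
    have hlt := (hΛ' ρ).1 hmem
    have hle := hplay s ρ hρ
    rw [← G.owned_one_sub] at hτ hτv
    -- A single play in `Λ_{1-j}` forces `v s < -(2d+2)`, so the opponent's optimal `τ` wins the
    -- core objective from `s`.
    refine hs ⟨ParityGame.positionalStrategy τ hτ, ?_⟩
    rintro _ ⟨ρ', ⟨rfl, hρ', hcomp⟩, rfl⟩
    have h' : -v (ρ' 0) ≤ -f ρ' := hτv ρ' hρ' (ParityGame.followsPos_of_compatible hcomp)
    rw [hΛ']
    omega
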